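/- Let $(X_i,Y_i)_{i\ge 1}$ be independent, identically distributed random vectors in $\mathbb R^2$ with continuous marginal distribution functions $F_X,F_Y$, and let $C(u,v)=\Pr\bigl(F_X(X_1)\le u,\;F_Y(Y_1)\le v\bigr)$ be their copula. Suppose that $C$ admits a lower tail expansion of tail order $\kappa=1$ with tail dependence function $b:(0,\infty)^2\to(0,\infty)$, that is, $$\frac{C(uw_1,uw_2)}{u}=b(w_1,w_2)+R(u;w_1,w_2),\qquad R(u;w_1,w_2)\to 0\ \text{ as } u\downarrow 0 \text{ for all } w_1,w_2>0.$$ For $n\ge 1$ and $1\le i\le n$ put $$U_{i,n}=\frac1n\sum_{j=1}^n\mathbf 1(X_j\le X_i),\qquad V_{i,n}=\frac1n\sum_{j=1}^n\mathbf 1(Y_j\le Y_i),\qquad \widehat C_n(u,v)=\frac1n\sum_{i=1}^n\mathbf 1\{U_{i,n}\le u,\;V_{i,n}\le v\}.$$ Let $(k_n)$ be a sequence of real numbers with $k_n\to\infty$ and $k_n/n\to 0$ as $n\to\infty$, let $p_n=k_n/n$, let $\mathcal S_1=\{(w_1,w_2): w_1>0,\;w_2>0,\;w_1+w_2=2\}$,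 and define the empirical tail dependence function $$\widehat b_{k_n,n}(w_1,w_2)=\frac{\widehat C_n(p_nw_1,p_nw_2)}{p_n}.$$ Then, as $n\to\infty$, the deviation below (which is finite for every outcome) converges to $0$ in probability: $$\sup_{(w_1,w_2)\in\mathcal S_1}\bigl|\widehat b_{k_n,n}(w_1,w_2)-b(w_1,w_2)\bigr|\xrightarrow{\;P\;}0 .$$ -/

import Mathlib

open MeasureTheory ProbabilityTheory Filter Topology

noncomputable section

namespace TailDependence

/-- The copula of a pair of real random variables with continuous margins: the joint distribution
function of `(F_X(X), F_Y(Y))`, where `F_X`, `F_Y` are the marginal distribution functions. -/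
def copula {Ω : Type*} [MeasurableSpace Ω] (μ : Measure Ω) (X Y : Ω → ℝ) (u v : ℝ) : ℝ :=
  μ.real {ω | cdf (μ.map X) (X ω) ≤ u ∧ cdf (μ.map Y) (Y ω) ≤ v}

/-- The remainder of the first-order lower tail expansion
`C(u w₁, u w₂) / u = b(w₁, w₂) + R(u; w₁, w₂)`. -/
def tailRemainder (C b : ℝ → ℝ → ℝ) (u w₁ w₂ : ℝ) : ℝ :=
  C (u * w₁) (u * w₂) / u - b w₁ w₂

/-- `C` admits a lower tail expansion of tail order `κ = 1` with tail dependence function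
`b : (0, ∞)² → (0, ∞)`: the remainder `R(u; w₁, w₂)` vanishes as `u ↓ 0`. Only pointwise
convergence is demanded, which is implied by every form of uniform convergence. -/
structure HasTailOrderOne (C b : ℝ → ℝ → ℝ) : Prop where
  pos : ∀ w₁ w₂ : ℝ, 0 < w₁ → 0 < w₂ → 0 < b w₁ w₂
  remainder_tendsto : ∀ w₁ w₂ : ℝ, 0 < w₁ → 0 < w₂ →
    Tendsto (fun u => tailRemainder C b u w₁ w₂) (𝓝[>] 0) (𝓝 0)

/-- The pseudo-observation `n⁻¹ ∑_{j < n} 1(x_j ≤ x_i)` (the rank of `x_i` among the first `n`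
values, divided by `n`). Samples are indexed from `0`. -/
def pseudoObs (x : ℕ → ℝ) (n i : ℕ) : ℝ :=
  (n : ℝ)⁻¹ * ∑ j ∈ Finset.range n, if x j ≤ x i then 1 else 0

/-- The empirical copula of the first `n` observations, built from the pseudo-observations. -/
def empiricalCopula (x y : ℕ → ℝ) (n : ℕ) (u v : ℝ) : ℝ :=
  (n : ℝ)⁻¹ * ∑ i ∈ Finset.range n,
    if pseudoObs x n i ≤ u ∧ pseudoObs y n i ≤ v then 1 else 0

/-- The empirical tail dependence function `Ĉ_n(p w₁, p w₂) / p`, where `p = k / n`. -/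
def empiricalTailDep (x y : ℕ → ℝ) (k : ℝ) (n : ℕ) (w₁ w₂ : ℝ) : ℝ :=
  empiricalCopula x y n (k / n * w₁) (k / n * w₂) / (k / n)

/-- The open segment `{(w₁, w₂) : w₁ > 0, w₂ > 0, w₁ + w₂ = 2}`. -/
def simplexOne : Set (ℝ × ℝ) := {w | 0 < w.1 ∧ 0 < w.2 ∧ w.1 + w.2 = 2}

end TailDependence

end

open MeasureTheory ProbabilityTheory Filter Topology

namespace TailDependence

/-! ### The probability integral transform -/

/-! Ranks are compared with the uniform variables `F (X i)`, `G (Y i)`. Counts in sets of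
probability about `c * k / n`, divided by `k`, concentrate at `c` by Chebyshev
(`tendsto_measure_hitCount_div`). On a finite grid of mesh `δ` this controls marginal and joint
counts simultaneously. The marginal counts sandwich each rank event between events for `F`, `G` at
grid points within `2 * δ`; the joint counts there are close to `b`. As `b` is 1-Lipschitz in each
variable and at most the minimum of its arguments, grid control is uniform control
(`abs_empiricalTailDep_sub_le`), even near the ends of the segment. -/

theorem measureReal_cdf_le {Ω : Type*} [MeasurableSpace Ω] (μ : Measure Ω)
    [IsProbabilityMeasure μ] {X : Ω → ℝ} (hX : Measurable X)
    (hF : Continuous (cdf (μ.map X))) {u : ℝ} (hu0 : 0 < u) (hu1 : u < 1) :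
    μ.real {ω | cdf (μ.map X) (X ω) ≤ u} = u := by
  have : IsProbabilityMeasure (μ.map X) := Measure.isProbabilityMeasure_map hX.aemeasurable
  have hsurj : ∀ v, 0 < v → v < 1 → ∃ x, cdf (μ.map X) x = v := by
    intro v h0 h1
    obtain ⟨a, ha⟩ := ((tendsto_cdf_atBot (μ.map X)).eventually_lt_const h0).exists
    obtain ⟨c, hc⟩ := ((tendsto_cdf_atTop (μ.map X)).eventually_const_lt h1).exists
    exact mem_range_of_exists_le_of_exists_ge hF ⟨a, ha.le⟩ ⟨c, hc.le⟩
  have hval : ∀ x, μ.real {ω | X ω ≤ x} = cdf (μ.map X) x := by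
    intro x
    rw [cdf_eq_real, map_measureReal_apply hX measurableSet_Iic]
    rfl
  apply le_antisymm
  -- `F` may be flat at level `u`, so `F (X ω) ≤ u` need not give `X ω ≤ x` when `F x = u`; it does
  -- when `F x = v > u`.
  · refine le_of_forall_gt_imp_ge_of_dense fun v hv => ?_
    rcases le_or_gt 1 v with h1 | h1
    · exact measureReal_le_one.trans h1
    obtain ⟨x, hx⟩ := hsurj v (hu0.trans hv) h1
    rw [← hx, ← hval]
    refine measureReal_mono fun ω hω => ?_
    simp only [Set.mem_ofPred_eq] at hω ⊢
    by_contra! hlt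
    linarith [monotone_cdf (μ.map X) hlt.le]
  · obtain ⟨x, hx⟩ := hsurj u hu0 hu1
    calc u = μ.real {ω | X ω ≤ x} := by rw [hval, hx]
      _ ≤ _ := measureReal_mono fun ω hω => by
        simpa [hx] using monotone_cdf (μ.map X) hω

/-! ### Copulas and tail dependence functions -/

section Copula

variable {Ω : Type*} [MeasurableSpace Ω] {μ : Measure Ω} [IsProbabilityMeasure μ] {X Y : Ω → ℝ}

theorem copula_le_left (hX : Measurable X) (hF : Continuous (cdf (μ.map X))) {u v : ℝ}
    (hu0 : 0 < u) (hu1 : u < 1) : copula μ X Y u v ≤ u := by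
  conv_rhs => rw [← measureReal_cdf_le μ hX hF hu0 hu1]
  exact measureReal_mono fun _ h => h.1

theorem copula_le_right (hY : Measurable Y) (hG : Continuous (cdf (μ.map Y))) {u v : ℝ}
    (hv0 : 0 < v) (hv1 : v < 1) : copula μ X Y u v ≤ v := by
  conv_rhs => rw [← measureReal_cdf_le μ hY hG hv0 hv1]
  exact measureReal_mono fun _ h => h.2

theorem measureReal_lt_cdf_le (hX : Measurable X) (hF : Continuous (cdf (μ.map X))) {u u' : ℝ}
    (hu0 : 0 < u) (huu : u ≤ u') (hu1 : u' < 1) :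
    μ.real {ω | u < cdf (μ.map X) (X ω) ∧ cdf (μ.map X) (X ω) ≤ u'} = u' - u := by
  have hm : Measurable fun ω => cdf (μ.map X) (X ω) := (monotone_cdf _).measurable.comp hX
  have h := measureReal_sdiff (μ := μ) (s₁ := {ω | cdf (μ.map X) (X ω) ≤ u'})
    (s₂ := {ω | cdf (μ.map X) (X ω) ≤ u}) (fun ω (hω : _ ≤ u) => hω.trans huu)
    (measurableSet_le hm measurable_const)
  rw [measureReal_cdf_le μ hX hF hu0 (huu.trans_lt hu1),
    measureReal_cdf_le μ hX hF (hu0.trans_le huu) hu1] at h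
  rw [← h]
  congr 1
  ext ω
  simp [and_comm]

/-- The larger rectangle is covered by the smaller one and two strips, whose probabilities are their
widths by uniformity of the margins. -/
theorem copula_le_add (hX : Measurable X) (hY : Measurable Y)
    (hF : Continuous (cdf (μ.map X))) (hG : Continuous (cdf (μ.map Y))) {u u' v v' : ℝ}
    (hu0 : 0 < u) (huu : u ≤ u') (hu1 : u' < 1) (hv0 : 0 < v) (hvv : v ≤ v') (hv1 : v' < 1) :
    copula μ X Y u' v' ≤ copula μ X Y u v + (u' - u) + (v' - v) := by
  rw [← measureReal_lt_cdf_le hX hF hu0 huu hu1, ← measureReal_lt_cdf_le hY hG hv0 hvv hv1]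
  refine le_trans (measureReal_mono ?_)
    ((measureReal_union_le (μ := μ) _ _).trans (add_le_add_left (measureReal_union_le _ _) _))
  rintro ω ⟨h1, h2⟩
  simp only [Set.mem_union, Set.mem_ofPred_eq]
  grind

theorem HasTailOrderOne.tendsto_div {C b : ℝ → ℝ → ℝ} (hb : HasTailOrderOne C b) {s t : ℝ}
    (hs : 0 < s) (ht : 0 < t) :
    Tendsto (fun u => C (u * s) (u * t) / u) (𝓝[>] 0) (𝓝 (b s t)) := by
  simpa [tailRemainder] using (hb.remainder_tendsto s t hs ht).add_const (b s t)

theorem eventually_mul_mem_Ioo {s : ℝ} (hs : 0 < s) :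
    ∀ᶠ u in 𝓝[>] (0 : ℝ), 0 < u * s ∧ u * s < 1 := by
  filter_upwards [Ioo_mem_nhdsGT (inv_pos.2 hs)] with u hu
  exact ⟨mul_pos hu.1 hs, (lt_inv_mul_iff₀' hs).1 (by simpa using hu.2)⟩

variable {b : ℝ → ℝ → ℝ}

theorem HasTailOrderOne.le_left (hb : HasTailOrderOne (copula μ X Y) b) (hX : Measurable X)
    (hF : Continuous (cdf (μ.map X))) {s t : ℝ} (hs : 0 < s) (ht : 0 < t) : b s t ≤ s := by
  refine le_of_tendsto (hb.tendsto_div hs ht) ?_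
  filter_upwards [self_mem_nhdsWithin, eventually_mul_mem_Ioo hs] with u (hu : 0 < u) h
  rw [div_le_iff₀' hu]
  exact copula_le_left hX hF h.1 h.2

theorem HasTailOrderOne.le_right (hb : HasTailOrderOne (copula μ X Y) b) (hY : Measurable Y)
    (hG : Continuous (cdf (μ.map Y))) {s t : ℝ} (hs : 0 < s) (ht : 0 < t) : b s t ≤ t := by
  refine le_of_tendsto (hb.tendsto_div hs ht) ?_
  filter_upwards [self_mem_nhdsWithin, eventually_mul_mem_Ioo ht] with u (hu : 0 < u) h
  rw [div_le_iff₀' hu]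
  exact copula_le_right hY hG h.1 h.2

theorem HasTailOrderOne.le_add (hb : HasTailOrderOne (copula μ X Y) b) (hX : Measurable X)
    (hY : Measurable Y) (hF : Continuous (cdf (μ.map X))) (hG : Continuous (cdf (μ.map Y)))
    {s s' t t' : ℝ} (hs : 0 < s) (hss : s ≤ s') (ht : 0 < t) (htt : t ≤ t') :
    b s' t' ≤ b s t + (s' - s) + (t' - t) := by
  have hs' := hs.trans_le hss
  have ht' := ht.trans_le htt
  refine le_of_tendsto_of_tendsto (hb.tendsto_div hs' ht')
    (((hb.tendsto_div hs ht).add_const (s' - s)).add_const (t' - t)) ?_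
  filter_upwards [self_mem_nhdsWithin, eventually_mul_mem_Ioo hs, eventually_mul_mem_Ioo hs',
    eventually_mul_mem_Ioo ht, eventually_mul_mem_Ioo ht'] with u (hu : 0 < u) h1 h2 h3 h4
  have h := copula_le_add (μ := μ) hX hY hF hG h1.1 (by gcongr) h2.2 h3.1 (by gcongr) h4.2
  rw [div_le_iff₀ hu]
  calc _ ≤ _ := h
    _ = _ := by field_simp

end Copula

/-! ### Counts and their law of large numbers -/

/-- The number of indices `i < n` for which `z i` lies in `A`. -/
noncomputable def hitCount {E : Type*} (z : ℕ → E) (A : Set E) (n : ℕ) : ℝ :=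
  ∑ i ∈ Finset.range n, A.indicator (fun _ => (1 : ℝ)) (z i)

theorem hitCount_le_hitCount {E E' : Type*} {z : ℕ → E} {z' : ℕ → E'} {A : Set E} {B : Set E'}
    (n : ℕ) (h : ∀ i, z i ∈ A → z' i ∈ B) : hitCount z A n ≤ hitCount z' B n := by
  refine Finset.sum_le_sum fun i _ => ?_
  by_cases hi : z i ∈ A
  · simp [hi, h i hi]
  · rw [Set.indicator_of_notMem hi]
    exact Set.indicator_nonneg (fun _ _ => zero_le_one) _

theorem hitCount_nonneg {E : Type*} (z : ℕ → E) (A : Set E) (n : ℕ) : 0 ≤ hitCount z A n :=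
  Finset.sum_nonneg fun _ _ => Set.indicator_nonneg (fun _ _ => zero_le_one) _

theorem hitCount_le {E : Type*} (z : ℕ → E) (A : Set E) (n : ℕ) : hitCount z A n ≤ n := by
  refine (Finset.sum_le_sum fun i _ =>
    Set.indicator_le_self' (f := fun _ => (1 : ℝ)) (fun _ _ => zero_le_one) (z i)).trans ?_
  simp

/-- A weak law of large numbers for counts in sets that vary with the sample size. -/
theorem tendsto_measure_hitCount_div {Ω E : Type*} [MeasurableSpace Ω] [MeasurableSpace E]
    {μ : Measure Ω} [IsProbabilityMeasure μ] {Z : ℕ → Ω → E} (hZ : ∀ i, Measurable (Z i))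
    (hindep : iIndepFun Z μ) (hident : ∀ i, IdentDistrib (Z i) (Z 0) μ μ)
    {A : ℕ → Set E} (hA : ∀ n, MeasurableSet (A n)) {k : ℕ → ℝ} (hk : Tendsto k atTop atTop)
    {c : ℝ} (hc : Tendsto (fun n : ℕ => μ.real (Z 0 ⁻¹' A n) / (k n / n)) atTop (𝓝 c))
    {δ : ℝ} (hδ : 0 < δ) :
    Tendsto (fun n => μ {ω | δ ≤ |hitCount (fun i => Z i ω) (A n) n / k n - c|}) atTop (𝓝 0) := by
  set q : ℕ → ℝ := fun n => μ.real (Z 0 ⁻¹' A n) with hq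
  have hmem : ∀ n i, MemLp (fun ω => (A n).indicator (fun _ => (1 : ℝ)) (Z i ω)) 2 μ :=
    fun n i => MemLp.of_bound
      ((measurable_const.indicator (hA n)).comp (hZ i)).aestronglyMeasurable 1
      (ae_of_all _ fun ω => by by_cases h : Z i ω ∈ A n <;> simp [h])
  have hint : ∀ n i, ∫ ω, (A n).indicator (fun _ => (1 : ℝ)) (Z i ω) ∂μ = q n := by
    intro n i
    have : (fun ω => (A n).indicator (fun _ => (1 : ℝ)) (Z i ω))
        = (Z i ⁻¹' A n).indicator (fun _ => (1 : ℝ)) := rfl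
    rw [this, integral_indicator_const _ (hZ i (hA n))]
    simp [hq, measureReal_def, (hident i).measure_mem_eq (hA n)]
  have hvar : ∀ n i, variance (fun ω => (A n).indicator (fun _ => (1 : ℝ)) (Z i ω)) μ ≤ q n := by
    intro n i
    refine (variance_le_expectation_sq (hmem n i).1).trans_eq ?_
    rw [← hint n i]
    refine integral_congr_ae (ae_of_all _ fun ω => ?_)
    by_cases h : Z i ω ∈ A n <;> simp [h]
  have hsum : ∀ n, (fun ω => hitCount (fun i => Z i ω) (A n) n)
      = ∑ i ∈ Finset.range n, fun ω => (A n).indicator (fun _ => (1 : ℝ)) (Z i ω) := by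
    intro n
    ext ω
    simp [hitCount]
  -- An indicator equals its square, so the variance of the count is at most its mean `n * q n`,
  -- which is of order at most `k n`; deviations of order `k n` then have probability `O(1 / k n)`.
  have hcheb : ∀ n, ∀ r > 0, μ {ω | r ≤ |hitCount (fun i => Z i ω) (A n) n - n * q n|}
      ≤ ENNReal.ofReal (n * q n / r ^ 2) := by
    intro n r hr
    have hL : MemLp (fun ω => hitCount (fun i => Z i ω) (A n) n) 2 μ := by
      rw [hsum]
      exact memLp_finsetSum' _ fun i _ => hmem n i
    have hE : ∫ ω, hitCount (fun i => Z i ω) (A n) n ∂μ = n * q n := by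
      simp only [hitCount]
      rw [integral_finsetSum _ fun i _ => (hmem n i).integrable (by norm_num)]
      simp [hint]
    have hV : variance (fun ω => hitCount (fun i => Z i ω) (A n) n) μ ≤ n * q n := by
      rw [hsum, IndepFun.variance_sum fun i _ => hmem n i]
      · exact (Finset.sum_le_sum fun i _ => hvar n i).trans (by simp)
      · intro i _ j _ hij
        exact (hindep.indepFun hij).comp (measurable_const.indicator (hA n))
          (measurable_const.indicator (hA n))
    have h := meas_ge_le_variance_div_sq hL hr
    rw [hE] at h
    exact h.trans (ENNReal.ofReal_le_ofReal (by gcongr))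
  have hbound : Tendsto (fun n : ℕ => ENNReal.ofReal (q n / (k n / n) * (4 / δ ^ 2) * (k n)⁻¹))
      atTop (𝓝 0) := by
    have := (hc.mul_const (4 / δ ^ 2)).mul hk.inv_tendsto_atTop
    rw [mul_zero] at this
    simpa using ENNReal.tendsto_ofReal this
  refine tendsto_of_tendsto_of_tendsto_of_le_of_le' tendsto_const_nhds hbound
    (Eventually.of_forall fun _ => zero_le) ?_
  filter_upwards [hk.eventually_gt_atTop 0, Metric.tendsto_nhds.1 hc (δ / 2) (half_pos hδ)]
    with n hkn hcn
  rw [Real.dist_eq] at hcn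
  refine (measure_mono fun ω (hω : δ ≤ _) => ?_).trans
    ((hcheb n (k n * (δ / 2)) (by positivity)).trans_eq ?_)
  · have h1 : δ / 2 ≤ |hitCount (fun i => Z i ω) (A n) n / k n - q n / (k n / n)| := by
      have := abs_sub_le (hitCount (fun i => Z i ω) (A n) n / k n) (q n / (k n / n)) c
      linarith
    have h2 : hitCount (fun i => Z i ω) (A n) n - n * q n
        = k n * (hitCount (fun i => Z i ω) (A n) n / k n - q n / (k n / n)) := by
      rw [div_div_eq_mul_div]
      field_simp
    rw [Set.mem_ofPred_eq, h2, abs_mul, abs_of_pos hkn]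
    gcongr
  · congr 1
    rw [div_div_eq_mul_div]
    field_simp
    ring

/-! ### Deterministic comparison of ranks with transformed observations -/

theorem pseudoObs_eq (x : ℕ → ℝ) (n i : ℕ) :
    pseudoObs x n i = (n : ℝ)⁻¹ * hitCount x (Set.Iic (x i)) n := by
  classical
  simp [pseudoObs, hitCount, Set.indicator_apply]

theorem empiricalCopula_eq (x y : ℕ → ℝ) (n : ℕ) (u v : ℝ) :
    empiricalCopula x y n u v =
      (n : ℝ)⁻¹ * hitCount id {i | pseudoObs x n i ≤ u ∧ pseudoObs y n i ≤ v} n := by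
  classical
  simp [empiricalCopula, hitCount, Set.indicator_apply]

theorem empiricalTailDep_eq (x y : ℕ → ℝ) (k : ℝ) {n : ℕ} (hn : 0 < n) (w₁ w₂ : ℝ) :
    empiricalTailDep x y k n w₁ w₂ =
      hitCount id {i | pseudoObs x n i ≤ k / n * w₁ ∧ pseudoObs y n i ≤ k / n * w₂} n / k := by
  have : (n : ℝ) ≠ 0 := by positivity
  rw [empiricalTailDep, empiricalCopula_eq]
  rw [div_div_eq_mul_div]
  field_simp

/-- A crude bound, needed only for finiteness of the supremum. It covers `k ≤ 0` and `n = 0` as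
well, since division by zero gives zero on both sides. -/
theorem abs_empiricalTailDep_le (x y : ℕ → ℝ) (k : ℝ) (n : ℕ) (w₁ w₂ : ℝ) :
    |empiricalTailDep x y k n w₁ w₂| ≤ |k / n|⁻¹ := by
  rw [empiricalTailDep, empiricalCopula_eq, abs_div, div_eq_mul_inv]
  refine mul_le_of_le_one_left (by positivity) ?_
  rw [abs_of_nonneg (mul_nonneg (by positivity) (hitCount_nonneg _ _ _))]
  calc _ ≤ (n : ℝ)⁻¹ * n := by gcongr; exact hitCount_le _ _ _
    _ ≤ 1 := inv_mul_le_one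

section Ranks

variable {F : ℝ → ℝ} {x : ℕ → ℝ} {k q w : ℝ} {n i : ℕ}

theorem pseudoObs_le_of_hitCount_div_le (hF : Monotone F) (hn : 0 < n) (hk : 0 < k)
    (h : hitCount x {a | F a ≤ q} n / k ≤ w) (hi : F (x i) ≤ q) :
    pseudoObs x n i ≤ k / n * w := by
  rw [pseudoObs_eq, div_mul_eq_mul_div, inv_mul_eq_div]
  gcongr
  rw [div_le_iff₀' hk] at h
  exact (hitCount_le_hitCount n fun j (hj : x j ≤ x i) => (hF hj).trans hi).trans h

/-- If `F (x i) > q`, every point counted at level `q` lies below `x i`, so the rank of `x i` is too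
large. Ties are harmless. -/
theorem le_of_pseudoObs_le_of_lt_hitCount_div (hF : Monotone F) (hn : 0 < n) (hk : 0 < k)
    (h : w < hitCount x {a | F a ≤ q} n / k) (hi : pseudoObs x n i ≤ k / n * w) :
    F (x i) ≤ q := by
  by_contra! hlt
  rw [pseudoObs_eq, div_mul_eq_mul_div, inv_mul_eq_div,
    div_le_div_iff_of_pos_right (by positivity)] at hi
  rw [lt_div_iff₀' hk] at h
  refine absurd (h.trans_le ((hitCount_le_hitCount n fun j hj => ?_).trans hi)) (lt_irrefl _)
  exact (hF.reflect_lt (lt_of_le_of_lt hj hlt)).le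

end Ranks

/-- If the marginal and joint scaled counts agree up to `δ` with their limits on a grid of mesh `δ`,
then the empirical tail dependence function is uniformly close to `b`. -/
theorem abs_empiricalTailDep_sub_le {F G : ℝ → ℝ} (hF : Monotone F) (hG : Monotone G)
    {b : ℝ → ℝ → ℝ}
    (hleft : ∀ s t, 0 < s → 0 < t → b s t ≤ s) (hright : ∀ s t, 0 < s → 0 < t → b s t ≤ t)
    (hadd : ∀ s s' t t', 0 < s → s ≤ s' → 0 < t → t ≤ t' →
      b s' t' ≤ b s t + (s' - s) + (t' - t))
    {x y : ℕ → ℝ} {n J : ℕ} {k p δ : ℝ} (hn : 0 < n) (hk : 0 < k) (hδ : 0 < δ)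
    (hJ : 2 / δ + 2 ≤ J)
    (hx : ∀ i ∈ Finset.Icc 1 J,
      |hitCount x {a | F a ≤ p * (i * δ)} n / k - i * δ| < δ)
    (hy : ∀ i ∈ Finset.Icc 1 J,
      |hitCount y {a | G a ≤ p * (i * δ)} n / k - i * δ| < δ)
    (hxy : ∀ i ∈ Finset.Icc 1 J, ∀ j ∈ Finset.Icc 1 J,
      |hitCount (fun m => (x m, y m)) {z | F z.1 ≤ p * (i * δ) ∧ G z.2 ≤ p * (j * δ)} n / k
        - b (i * δ) (j * δ)| < δ)
    {w₁ w₂ : ℝ} (h₁ : 0 < w₁) (h₁' : w₁ < 2) (h₂ : 0 < w₂) (h₂' : w₂ < 2) :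
    |empiricalTailDep x y k n w₁ w₂ - b w₁ w₂| ≤ 5 * δ := by
  rw [empiricalTailDep_eq x y k hn]
  have hgrid : ∀ w, 0 < w → w < 2 → ∃ i : ℕ, i + 2 ≤ J ∧ i * δ < w ∧ w ≤ (i + 1) * δ := by
    intro w h0 h2
    obtain ⟨i, hi⟩ : ∃ i : ℕ, ⌈w / δ⌉₊ = i + 1 :=
      Nat.exists_eq_succ_of_ne_zero (Nat.ceil_pos.2 (by positivity)).ne'
    have hle := Nat.le_ceil (w / δ)
    have hlt := Nat.ceil_lt_add_one (a := w / δ) (by positivity)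
    rw [hi] at hle hlt
    push_cast at hle hlt
    refine ⟨i, ?_, (lt_div_iff₀ hδ).1 (by linarith), (div_le_iff₀ hδ).1 hle⟩
    have : (i : ℝ) + 2 < J + 1 := by
      have : w / δ < 2 / δ := by gcongr
      linarith
    exact_mod_cast Nat.lt_succ_iff.1 (by exact_mod_cast this)
  obtain ⟨i, hiJ, hi, hi'⟩ := hgrid w₁ h₁ h₁'
  obtain ⟨j, hjJ, hj, hj'⟩ := hgrid w₂ h₂ h₂'
  rw [abs_le]
  constructor
  · have hnn := div_nonneg (hitCount_nonneg id
      {i | pseudoObs x n i ≤ k / n * w₁ ∧ pseudoObs y n i ≤ k / n * w₂} n) hk.le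
    -- The lower grid index `i - 1` must be positive. Otherwise `w₁ ≤ 2 * δ`, so `b w₁ w₂ ≤ 2 * δ`
    -- and nonnegativity of the count suffices.
    rcases Nat.lt_or_ge i 2 with hi2 | hi2
    · have : (i : ℝ) ≤ 1 := by exact_mod_cast Nat.lt_succ_iff.1 hi2
      nlinarith [hleft w₁ w₂ h₁ h₂]
    rcases Nat.lt_or_ge j 2 with hj2 | hj2
    · have : (j : ℝ) ≤ 1 := by exact_mod_cast Nat.lt_succ_iff.1 hj2
      nlinarith [hright w₁ w₂ h₁ h₂]
    have hmi : i - 1 ∈ Finset.Icc 1 J := Finset.mem_Icc.2 (by omega)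
    have hmj : j - 1 ∈ Finset.Icc 1 J := Finset.mem_Icc.2 (by omega)
    have hci : ((i - 1 : ℕ) : ℝ) = i - 1 := by push_cast [show 1 ≤ i by omega]; ring
    have hcj : ((j - 1 : ℕ) : ℝ) = j - 1 := by push_cast [show 1 ≤ j by omega]; ring
    have hxi := (abs_lt.1 (hx _ hmi)).2
    have hyj := (abs_lt.1 (hy _ hmj)).2
    have hz := (abs_lt.1 (hxy _ hmi _ hmj)).1
    have hi2' : (2 : ℝ) ≤ i := by exact_mod_cast hi2
    have hj2' : (2 : ℝ) ≤ j := by exact_mod_cast hj2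
    rw [hci] at hxi hz
    rw [hcj] at hyj hz
    have hcount := hitCount_le_hitCount (z := fun m => (x m, y m)) (z' := id)
      (A := {z | F z.1 ≤ p * ((i - 1) * δ) ∧ G z.2 ≤ p * ((j - 1) * δ)})
      (B := {i | pseudoObs x n i ≤ k / n * w₁ ∧ pseudoObs y n i ≤ k / n * w₂}) n
      fun m hm => ⟨pseudoObs_le_of_hitCount_div_le hF hn hk (by linarith) hm.1,
        pseudoObs_le_of_hitCount_div_le hG hn hk (by linarith) hm.2⟩
    have hdiv := div_le_div_of_nonneg_right hcount hk.le
    have hbb := hadd ((i - 1) * δ) w₁ ((j - 1) * δ) w₂ (mul_pos (by linarith) hδ) (by linarith)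
      (mul_pos (by linarith) hδ) (by linarith)
    linarith
  -- At index `i + 2` the scaled count strictly exceeds `(i + 1) * δ ≥ w₁`. The error is below `2 *
  -- δ` per coordinate plus `δ` for the joint count.
  · have hmi : i + 2 ∈ Finset.Icc 1 J := Finset.mem_Icc.2 (by omega)
    have hmj : j + 2 ∈ Finset.Icc 1 J := Finset.mem_Icc.2 (by omega)
    have hxi := (abs_lt.1 (hx _ hmi)).1
    have hyj := (abs_lt.1 (hy _ hmj)).1
    have hz := (abs_lt.1 (hxy _ hmi _ hmj)).2
    push_cast at hxi hyj hz
    have hcount := hitCount_le_hitCount (z := id) (z' := fun m => (x m, y m))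
      (A := {i | pseudoObs x n i ≤ k / n * w₁ ∧ pseudoObs y n i ≤ k / n * w₂})
      (B := {z | F z.1 ≤ p * ((i + 2) * δ) ∧ G z.2 ≤ p * ((j + 2) * δ)}) n
      fun m hm => ⟨le_of_pseudoObs_le_of_lt_hitCount_div hF hn hk (by linarith) hm.1,
        le_of_pseudoObs_le_of_lt_hitCount_div hG hn hk (by linarith) hm.2⟩
    have hdiv := div_le_div_of_nonneg_right hcount hk.le
    have hbb := hadd w₁ ((i + 2) * δ) w₂ ((j + 2) * δ) h₁ (by linarith) h₂ (by linarith)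
    linarith

end TailDependence

theorem mainTheorem9 {Ω : Type*} [MeasurableSpace Ω] (μ : Measure Ω) [IsProbabilityMeasure μ]
    (X Y : ℕ → Ω → ℝ)
    (hX : ∀ i, Measurable (X i)) (hY : ∀ i, Measurable (Y i))
    (hindep : iIndepFun (fun i ω => (X i ω, Y i ω)) μ)
    (hident : ∀ i, IdentDistrib (fun ω => (X i ω, Y i ω)) (fun ω => (X 0 ω, Y 0 ω)) μ μ)
    (hFX : Continuous (cdf (μ.map (X 0)))) (hFY : Continuous (cdf (μ.map (Y 0))))
    (b : ℝ → ℝ → ℝ)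
    (hb : TailDependence.HasTailOrderOne (TailDependence.copula μ (X 0) (Y 0)) b)
    (k : ℕ → ℝ) (hk : Tendsto k atTop atTop)
    (hkn : Tendsto (fun n : ℕ => k n / n) atTop (𝓝 0)) :
    (∀ n ω, BddAbove (Set.range fun w : TailDependence.simplexOne =>
      |TailDependence.empiricalTailDep (fun i => X i ω) (fun i => Y i ω) (k n) n w.1.1 w.1.2
        - b w.1.1 w.1.2|)) ∧
    TendstoInMeasure μ
      (fun n ω => ⨆ w : TailDependence.simplexOne,
        |TailDependence.empiricalTailDep (fun i => X i ω) (fun i => Y i ω) (k n) n w.1.1 w.1.2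
          - b w.1.1 w.1.2|)
      atTop (fun _ => (0 : ℝ)) := by 
  have hlt2 : ∀ w : TailDependence.simplexOne, w.1.1 < 2 ∧ w.1.2 < 2 := fun w => by
    obtain ⟨h1, h2, h3⟩ := w.2
    exact ⟨by linarith, by linarith⟩
  refine ⟨fun n ω => ?_, ?_⟩
  · refine ⟨|k n / n|⁻¹ + 2, ?_⟩
    rintro _ ⟨w, rfl⟩
    obtain ⟨h1, h2, -⟩ := w.2
    have hle := hb.le_left (hX 0) hFX h1 h2
    have hpos := hb.pos _ _ h1 h2
    refine (abs_sub _ _).trans (add_le_add (TailDependence.abs_empiricalTailDep_le _ _ _ _ _ _) ?_)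
    rw [abs_of_pos hpos]
    linarith [(hlt2 w).1]
  rw [tendstoInMeasure_iff_dist]
  intro ε hε
  set F := cdf (μ.map (X 0)) with hF
  set G := cdf (μ.map (Y 0)) with hG
  -- The deterministic bound `5 * δ` must be strictly below `ε`.
  set δ := ε / 6 with hδε
  have hδ : 0 < δ := by positivity
  obtain ⟨J, hJ⟩ := exists_nat_ge (2 / δ + 2)
  have hZ : ∀ i, Measurable fun ω => (X i ω, Y i ω) := fun i => (hX i).prodMk (hY i)
  have hFm : Measurable fun z : ℝ × ℝ => F z.1 := (monotone_cdf _).measurable.comp measurable_fst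
  have hGm : Measurable fun z : ℝ × ℝ => G z.2 := (monotone_cdf _).measurable.comp measurable_snd
  have hp : Tendsto (fun n : ℕ => k n / n) atTop (𝓝[>] 0) := by
    refine tendsto_nhdsWithin_iff.2 ⟨hkn, ?_⟩
    filter_upwards [hk.eventually_gt_atTop 0, eventually_gt_atTop 0] with n h1 h2
    exact div_pos h1 (by exact_mod_cast h2)
  have hgrid : ∀ i ∈ Finset.Icc 1 J, 0 < (i : ℝ) * δ := fun i hi =>
    mul_pos (by exact_mod_cast (Finset.mem_Icc.1 hi).1) hδ
  have hx : ∀ i ∈ Finset.Icc 1 J, Tendsto (fun n => μ {ω | δ ≤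
      |TailDependence.hitCount (fun m => (X m ω, Y m ω)) {z | F z.1 ≤ k n / n * (i * δ)} n / k n
        - i * δ|}) atTop (𝓝 0) := by
    intro i hi
    refine TailDependence.tendsto_measure_hitCount_div hZ hindep hident
      (A := fun n => {z | F z.1 ≤ k n / n * (i * δ)})
      (fun n => measurableSet_le hFm measurable_const) hk ?_ hδ
    refine tendsto_const_nhds.congr' ?_
    filter_upwards [hp.eventually (TailDependence.eventually_mul_mem_Ioo (hgrid i hi)),
      hp.eventually self_mem_nhdsWithin] with n hn (hn0 : 0 < k n / n)
    have := TailDependence.measureReal_cdf_le μ (hX 0) hFX hn.1 hn.2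
    rw [eq_div_iff hn0.ne', mul_comm]
    exact this.symm
  have hy : ∀ i ∈ Finset.Icc 1 J, Tendsto (fun n => μ {ω | δ ≤
      |TailDependence.hitCount (fun m => (X m ω, Y m ω)) {z | G z.2 ≤ k n / n * (i * δ)} n / k n
        - i * δ|}) atTop (𝓝 0) := by
    intro i hi
    refine TailDependence.tendsto_measure_hitCount_div hZ hindep hident
      (A := fun n => {z | G z.2 ≤ k n / n * (i * δ)})
      (fun n => measurableSet_le hGm measurable_const) hk ?_ hδ
    refine tendsto_const_nhds.congr' ?_
    filter_upwards [hp.eventually (TailDependence.eventually_mul_mem_Ioo (hgrid i hi)),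
      hp.eventually self_mem_nhdsWithin] with n hn (hn0 : 0 < k n / n)
    have := TailDependence.measureReal_cdf_le μ (hY 0) hFY hn.1 hn.2
    rw [eq_div_iff hn0.ne', mul_comm]
    exact this.symm
  have hxy : ∀ i ∈ Finset.Icc 1 J, ∀ j ∈ Finset.Icc 1 J, Tendsto (fun n => μ {ω | δ ≤
      |TailDependence.hitCount (fun m => (X m ω, Y m ω))
        {z | F z.1 ≤ k n / n * (i * δ) ∧ G z.2 ≤ k n / n * (j * δ)} n / k n
        - b (i * δ) (j * δ)|}) atTop (𝓝 0) := by
    intro i hi j hj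
    exact TailDependence.tendsto_measure_hitCount_div hZ hindep hident
      (A := fun n => {z | F z.1 ≤ k n / n * (i * δ) ∧ G z.2 ≤ k n / n * (j * δ)})
      (fun n => (measurableSet_le hFm measurable_const).inter
        (measurableSet_le hGm measurable_const)) hk
      ((hb.tendsto_div (hgrid i hi) (hgrid j hj)).comp hp) hδ
  have hsum := ((tendsto_finsetSum _ hx).add (tendsto_finsetSum _ hy)).add
    (tendsto_finsetSum _ fun i hi => tendsto_finsetSum _ (hxy i hi))
  simp only [Finset.sum_const_zero, add_zero] at hsum
  refine tendsto_of_tendsto_of_tendsto_of_le_of_le' tendsto_const_nhds hsum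
    (Eventually.of_forall fun _ => zero_le) ?_
  filter_upwards [hk.eventually_gt_atTop 0, eventually_gt_atTop 0] with n hkn0 hn0
  -- Union bound over the finitely many grid failures; outside them the deterministic estimate holds
  -- for all `w` at once.
  refine le_trans (measure_mono ?_) ((measure_union_le _ _).trans (add_le_add
    ((measure_union_le _ _).trans (add_le_add (measure_biUnion_finset_le _ _)
      (measure_biUnion_finset_le _ _)))
    ((measure_biUnion_finset_le _ _).trans
      (Finset.sum_le_sum fun i _ => measure_biUnion_finset_le _ _))))
  intro ω hω
  by_contra hgood
  simp only [Set.mem_union, Set.mem_iUnion, Set.mem_ofPred_eq, not_or, not_exists, not_le] at hgood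
  obtain ⟨⟨gx, gy⟩, gxy⟩ := hgood
  have hclose : ∀ w : TailDependence.simplexOne,
      |TailDependence.empiricalTailDep (fun i => X i ω) (fun i => Y i ω) (k n) n w.1.1 w.1.2
        - b w.1.1 w.1.2| ≤ 5 * δ := fun w =>
    TailDependence.abs_empiricalTailDep_sub_le (monotone_cdf (μ.map (X 0)))
      (monotone_cdf (μ.map (Y 0))) (fun _ _ => hb.le_left (hX 0) hFX)
      (fun _ _ => hb.le_right (hY 0) hFY)
      (fun _ _ _ _ => hb.le_add (hX 0) (hY 0) hFX hFY) hn0 hkn0 hδ hJ gx gy gxy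
      w.2.1 (hlt2 w).1 w.2.2.1 (hlt2 w).2
  have hsup := Real.iSup_le hclose (by positivity)
  rw [Set.mem_ofPred_eq, Real.dist_eq, sub_zero,
    abs_of_nonneg (Real.iSup_nonneg fun _ => abs_nonneg _)] at hω
  linarith
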